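/- There exists an oracle $A\subseteq\{0,1\}^*$ relative to which there is no complete total polynomial search problem with respect to many-one polynomial reductions. Here a total polynomial search problem relative to $A$ is given by a binary relation $R(x,y)$ on $\{0,1\}^*$ that is decidable in polynomial time by a deterministic Turing machine with oracle $A$, together with a polynomial $p$, such that for every $x$ there exists $y$ with $|y|\le p(|x|)$ and $R(x,y)$; every such $y$ is called a solution for $x$. For two such problems $R$ and $S$, $R$ is many-one polynomially reducible to $S$ relative to $A$ if there is a deterministic polynomial-time Turing machine with access to the oracle $A$ which, when given in addition any oracle that answers every query $z$ with a solution of $S$ for $z$, outputs on every input $x$ a solution of $R$ for $x$, and makes at most one query to this additional oracle. A total polynomial search problem $S$ relative to $A$ is complete if every total polynomial search problem relative to $A$ is many-one polynomially reducible to $S$ relative to $A$. -/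

import Mathlib

namespace OracleSearch

/-- Binary strings; the length `|x|` is `x.length`. -/
abbrev Word := List Bool

/-- The tapes of a machine with `a` input tapes and `w` work tapes: `Sum.inl i` is the `i`-th input
tape, `Sum.inr (some j)` the `j`-th work tape, and `Sum.inr none` the answer tape, on which the
oracles write their replies. All of them are two-way infinite read-write tapes. -/
abbrev TapeIx (a w : ℕ) := Fin a ⊕ Option (Fin w)

/-- Instructions. `ι` names the available oracles, `T` the tapes, `Q` the states.
* `work`: write a symbol (`none` is the blank) on each tape, move each head by at most one cell,
  append at most one bit to the write-only tape, and go to the next state;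
* `ask i q`: submit the word on the write-only tape to oracle `i`; that tape is erased, the reply is
  put on the answer tape (replacing its content) and the machine goes to state `q`;
* `halt`: stop; the word on the write-only tape is the output. -/
inductive Instr (ι T Q : Type) where
  | work (write : T → Option Bool) (move : T → Option Turing.Dir) (emit : Option Bool) (next : Q)
  | ask (oracle : ι) (next : Q)
  | halt

/-- Deterministic multitape oracle Turing machines with `a` input tapes, tape alphabet
`{blank, 0, 1}`, and oracles named by `ι`. The next instruction depends on the state and on the
symbols scanned by all the heads. -/
structure Machine (ι : Type) (a : ℕ) where
  numWork : ℕ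
  numStates : ℕ
  start : Fin numStates
  instr : Fin numStates → (TapeIx a numWork → Option Bool) →
    Instr ι (TapeIx a numWork) (Fin numStates)

/-- A tape that holds the word `x` and blanks, with the head on the first symbol of `x`. -/
def wordTape (x : Word) : Turing.Tape (Option Bool) := Turing.Tape.mk₁ (x.map some)

namespace Machine

variable {ι : Type} {a : ℕ}

/-- Configurations; `out` is the content of the write-only tape. -/
structure Config (M : Machine ι a) where
  state : Fin M.numStates
  tape : TapeIx a M.numWork → Turing.Tape (Option Bool)
  out : Word

variable (M : Machine ι a)

/-- The initial configuration on the input words `x 0, …, x (a - 1)`. -/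
def init (x : Fin a → Word) : M.Config where
  state := M.start
  tape := Sum.elim (fun i => wordTape (x i)) (fun _ => wordTape [])
  out := []

/-- The instruction to be executed in a configuration. -/
def current (c : M.Config) : Instr ι (TapeIx a M.numWork) (Fin M.numStates) :=
  M.instr c.state (fun k => (c.tape k).head)

/-- One step of computation with oracles `O`, where `O i z` is the reply of oracle `i` to the
query `z`. A halted configuration does not change. -/
def step (O : ι → Word → Word) (c : M.Config) : M.Config :=
  match M.current c with
  | .work write move emit next =>
    { state := next
      tape := fun k =>
        match move k with
        | none => (c.tape k).write (write k)
        | some d => ((c.tape k).write (write k)).move d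
      out := c.out ++ emit.toList }
  | .ask i next =>
    { state := next
      tape := Function.update c.tape (Sum.inr none) (wordTape (O i c.out))
      out := [] }
  | .halt => c

/-- The configuration after `t` steps on input `x`. -/
def conf (O : ι → Word → Word) (x : Fin a → Word) (t : ℕ) : M.Config :=
  (M.step O)^[t] (M.init x)

/-- On input `x` the machine has halted after at most `t` steps, with output `w`. -/
def HaltsWithin (O : ι → Word → Word) (x : Fin a → Word) (t : ℕ) (w : Word) : Prop :=
  M.current (M.conf O x t) = .halt ∧ (M.conf O x t).out = w

/-- The number of queries to oracle `i` in the whole computation on input `x`. -/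
noncomputable def queryCount (O : ι → Word → Word) (x : Fin a → Word) (i : ι) : ℕ∞ :=
  {t : ℕ | ∃ q, M.current (M.conf O x t) = .ask i q}.encard

end Machine

open Classical in
/-- The set `A` of words as an oracle: the reply to `z` is the one-bit word telling whether
`z ∈ A`. -/
noncomputable def membership (A : Set Word) (z : Word) : Word := [decide (z ∈ A)]

open Classical in
/-- The binary relation `r` is decidable in polynomial time relative to the oracle `A`. -/
def PolyTimeDecidable (A : Set Word) (r : Word → Word → Prop) : Prop :=
  ∃ (M : Machine Unit 2) (p : Polynomial ℕ), ∀ x y : Word,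
    M.HaltsWithin (fun _ => membership A) ![x, y] (p.eval (x.length + y.length)) [decide (r x y)]

/-- Total polynomial search problems relative to the oracle `A`. -/
structure TotalSearchProblem (A : Set Word) where
  rel : Word → Word → Prop
  bound : Polynomial ℕ
  decidable : PolyTimeDecidable A rel
  total : ∀ x, ∃ y : Word, y.length ≤ bound.eval x.length ∧ rel x y

namespace TotalSearchProblem

variable {A : Set Word}

/-- `y` is a solution for the instance `x`. -/
def IsSolution (R : TotalSearchProblem A) (x y : Word) : Prop :=
  y.length ≤ R.bound.eval x.length ∧ R.rel x y

end TotalSearchProblem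

/-- The two oracles available to a reduction relative to `A`: the ambient oracle `A` itself, and an
oracle that gives solutions to the target problem. -/
inductive OracleName where
  | ambient
  | solver

/-- The oracles of a reduction: `A`, and the solution oracle `σ`. -/
noncomputable def reductionOracles (A : Set Word) (σ : Word → Word) : OracleName → Word → Word
  | .ambient => membership A
  | .solver => σ

/-- `R` is many-one polynomially reducible to `S`, relative to `A`: some polynomial time machine with
oracle `A` solves `R` when it is given any oracle `σ` that gives solutions to `S`, and it makes at
most one query to `σ`. -/
def ManyOneReducible {A : Set Word} (R S : TotalSearchProblem A) : Prop :=
  ∃ (M : Machine OracleName 1) (p : Polynomial ℕ),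
    ∀ σ : Word → Word, (∀ z, S.IsSolution z (σ z)) → ∀ x : Word,
      (∃ w, M.HaltsWithin (reductionOracles A σ) ![x] (p.eval x.length) w ∧ R.IsSolution x w) ∧
      M.queryCount (reductionOracles A σ) ![x] .solver ≤ 1

/-- `S` is complete: every total polynomial search problem relative to `A` is many-one polynomially
reducible to `S`. -/
def IsComplete {A : Set Word} (S : TotalSearchProblem A) : Prop :=
  ∀ R : TotalSearchProblem A, ManyOneReducible R S

end OracleSearch

/-! The oracle is built by forcing. A condition fixes the oracle up to some length and promises that
finitely many lookup problems, indexed by `j`, stay total. Machines and polynomials are countable,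
so some ideal of conditions meets all requirements (`exists_generic_ideal`).

Let `e` present a candidate complete problem. If some extension of a condition forces an instance
without solutions, take it: `e` then presents no total problem. Otherwise promise totality of lookup
for a fresh `j`; this problem will not reduce to `e` (`isCofinal_kills_or_separates`).

To defeat a given reduction (`Separates.exists_defeats`), delete all lookup solutions for one large
length `n`. This violates the promise for `j` but none made before it, so `e` is still total
relative to the depleted oracle (`exists_solves`). Run the reduction on `1ⁿ` there, with solver
answers taken from `e`. The run and the verifications of its answers inspect only polynomially many
words, so one of the `2ⁿ` candidates of length `n` can be put back unnoticed and distinct from the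
output. The promise for `j` is restored, the run is unchanged, and its output is wrong. -/

namespace OracleSearch

/-! ### Countability of the requirements -/

section Countability

instance countable_instr {ι T Q : Type} [Countable ι] [Finite T] [Countable Q] :
    Countable (Instr ι T Q) := by
  let f : Instr ι T Q →
      ((T → Option Bool) × (T → Option Turing.Dir) × Option Bool × Q) ⊕ (ι × Q) ⊕ Unit
    | .work w m e q => .inl (w, m, e, q)
    | .ask i q => .inr (.inl (i, q))
    | .halt => .inr (.inr ())
  have : Countable Turing.Dir := by
    refine Function.Injective.countable (f := fun d => (decide (d = .left) : Bool)) ?_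
    rintro (_ | _) (_ | _) <;> simp
  refine Function.Injective.countable (f := f) ?_
  rintro (_ | _ | _) (_ | _ | _) h <;> simp_all [f]

instance countable_machine {ι : Type} [Countable ι] {a : ℕ} : Countable (Machine ι a) := by
  let f : Machine ι a → (w : ℕ) × (n : ℕ) × Fin n ×
      (Fin n → (TapeIx a w → Option Bool) → Instr ι (TapeIx a w) (Fin n)) :=
    fun M => ⟨M.numWork, M.numStates, M.start, M.instr⟩
  refine Function.Injective.countable (f := f) ?_
  rintro ⟨w, n, s, i⟩ ⟨w', n', s', i'⟩ h
  simp only [f, Sigma.mk.injEq] at h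
  obtain ⟨rfl, h⟩ := h
  have h := eq_of_heq h
  simp only [Sigma.mk.injEq] at h
  obtain ⟨rfl, h⟩ := h
  have h := eq_of_heq h
  simp_all

instance countable_polynomial : Countable (Polynomial ℕ) := by
  refine Function.Injective.countable
    (f := fun p : Polynomial ℕ => Finsupp.onFinset p.support p.coeff (by simp)) ?_
  intro p q h
  ext n
  simpa using DFunLike.congr_fun h n

instance countable_oracleName : Countable OracleName := by
  refine Function.Injective.countable
    (f := fun i : OracleName => match i with | .ambient => true | .solver => false) ?_
  rintro (_ | _) (_ | _) <;> simp

end Countability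

/-- The Rasiowa–Sikorski lemma for a countable family of cofinal sets. -/
theorem exists_generic_ideal {P ι : Type*} [Preorder P] [Nonempty P] [Countable ι]
    (D : ι → Set P) (hD : ∀ i, IsCofinal (D i)) :
    ∃ I : Order.Ideal P, ∀ i, ∃ x ∈ I, x ∈ D i := by
  have := Encodable.ofCountable ι
  let D' : ι → Order.Cofinal P := fun i => ⟨D i, hD i⟩
  refine ⟨Order.idealOfCofinals (Classical.arbitrary P) D', fun i => ?_⟩
  obtain ⟨x, hx, hxI⟩ := Order.cofinal_meets_idealOfCofinals (Classical.arbitrary P) D' i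
  exact ⟨x, hxI, hx⟩

/-! ### Polynomials against powers of two -/

section Growth

open Filter Asymptotics in
theorem polynomial_isLittleO_two_pow (f : Polynomial ℕ) :
    (fun n : ℕ => ((f.eval n : ℕ) : ℝ)) =o[atTop] fun n => (2 : ℝ) ^ n := by
  induction f using Polynomial.induction_on' with
  | add p q hp hq => simpa using hp.add hq
  | monomial k a =>
    simpa using (isLittleO_pow_const_const_pow_of_one_lt (R := ℝ) k one_lt_two).const_mul_left
      (a : ℝ)

theorem exists_polynomial_lt_two_pow (f : Polynomial ℕ) (N : ℕ) :
    ∃ n, N ≤ n ∧ f.eval n < 2 ^ n := by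
  have h := (polynomial_isLittleO_two_pow f).bound (c := 1 / 2) (by norm_num)
  obtain ⟨n, hn, hN⟩ := (h.and (Filter.eventually_ge_atTop N)).exists
  refine ⟨n, hN, ?_⟩
  have hpos : (0 : ℝ) < 2 ^ n := by positivity
  rw [Real.norm_of_nonneg (by positivity), Real.norm_of_nonneg hpos.le] at hn
  have : ((f.eval n : ℕ) : ℝ) < 2 ^ n := by linarith
  exact_mod_cast this

theorem eval_mono (f : Polynomial ℕ) : Monotone fun n : ℕ => f.eval n := by
  intro m n hmn
  simp only [Polynomial.eval_eq_sum, Polynomial.sum]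
  gcongr

end Growth

/-! ### Locality of oracle computations -/

namespace Machine

variable {ι : Type} {a : ℕ} (M : Machine ι a)

theorem conf_succ (O : ι → Word → Word) (x : Fin a → Word) (t : ℕ) :
    M.conf O x (t + 1) = M.step O (M.conf O x t) :=
  Function.iterate_succ_apply' _ _ _

theorem length_out_conf_le (O : ι → Word → Word) (x : Fin a → Word) (t : ℕ) :
    (M.conf O x t).out.length ≤ t := by
  induction t with
  | zero => simp [conf, init]
  | succ t ih =>
    rw [conf_succ, step]
    split
    · rename_i e _ _
      simp only [List.length_append]
      have : e.toList.length ≤ 1 := by cases e <;> simp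
      omega
    · simp
    · omega

/-- The contents of the write-only tape before time `T`; every query asked before time `T` is
among them. -/
def outs (O : ι → Word → Word) (x : Fin a → Word) (T : ℕ) : Finset Word :=
  (Finset.range T).image fun t => (M.conf O x t).out

theorem card_outs_le (O : ι → Word → Word) (x : Fin a → Word) (T : ℕ) :
    (M.outs O x T).card ≤ T :=
  Finset.card_image_le.trans_eq (Finset.card_range T)

theorem length_lt_of_mem_outs {O : ι → Word → Word} {x : Fin a → Word} {T : ℕ} {w : Word}
    (hw : w ∈ M.outs O x T) : w.length < T := by
  obtain ⟨t, ht, rfl⟩ := Finset.mem_image.1 hw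
  exact (M.length_out_conf_le O x t).trans_lt (Finset.mem_range.1 ht)

/-- A step consults the oracles only at the current content of the write-only tape, so agreement on
those contents propagates by induction. -/
theorem conf_congr {O O' : ι → Word → Word} {x : Fin a → Word} {T : ℕ}
    (h : ∀ w ∈ M.outs O x T, ∀ i, O i w = O' i w) {t : ℕ} (ht : t ≤ T) :
    M.conf O x t = M.conf O' x t := by
  induction t with
  | zero => rfl
  | succ t ih =>
    have hmem : (M.conf O x t).out ∈ M.outs O x T :=
      Finset.mem_image.2 ⟨t, Finset.mem_range.2 ht, rfl⟩
    rw [conf_succ, conf_succ, ← ih (by omega), step, step]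
    split
    · rfl
    · rw [h _ hmem]
    · rfl

theorem haltsWithin_congr {O O' : ι → Word → Word} {x : Fin a → Word} {T : ℕ}
    (h : ∀ w ∈ M.outs O x T, ∀ i, O i w = O' i w) (w : Word) :
    M.HaltsWithin O x T w ↔ M.HaltsWithin O' x T w := by
  rw [HaltsWithin, HaltsWithin, M.conf_congr h le_rfl]

end Machine

/-! ### Lookup problems and a machine deciding them -/

theorem head_mk_map_cons (L : Turing.ListBlank (Option Bool)) (b : Bool) (l : Word) :
    (Turing.Tape.mk' L (Turing.ListBlank.mk ((b :: l).map some))).head = some b := by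
  simp

theorem head_mk_map_nil (L : Turing.ListBlank (Option Bool)) :
    (Turing.Tape.mk' L (Turing.ListBlank.mk (([] : Word).map some))).head = none :=
  rfl

theorem move_right_mk_map_cons (L : Turing.ListBlank (Option Bool)) (b : Bool) (l : Word) :
    (Turing.Tape.mk' L (Turing.ListBlank.mk ((b :: l).map some))).move .right =
      Turing.Tape.mk' (L.cons (some b)) (Turing.ListBlank.mk (l.map some)) := by
  simp

/-- The word `1ʲ 0 1ⁿ 0 y`. -/
def code (j n : ℕ) (y : Word) : Word :=
  List.replicate j true ++ false :: (List.replicate n true ++ false :: y)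

theorem replicate_true_append_false_inj {m n : ℕ} {y z : Word}
    (h : List.replicate m true ++ false :: y = List.replicate n true ++ false :: z) :
    m = n ∧ y = z := by
  induction m generalizing n with
  | zero => cases n <;> simp_all [List.replicate_succ]
  | succ m ih =>
    cases n with
    | zero => simp [List.replicate_succ] at h
    | succ n =>
      simp only [List.replicate_succ, List.cons_append, List.cons.injEq, true_and] at h
      simpa using ih h

theorem code_inj {j n j' n' : ℕ} {y y' : Word} :
    code j n y = code j' n' y' ↔ j = j' ∧ n = n' ∧ y = y' := by
  refine ⟨fun h => ?_, by rintro ⟨rfl, rfl, rfl⟩; rfl⟩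
  obtain ⟨h1, h2⟩ := replicate_true_append_false_inj h
  exact ⟨h1, replicate_true_append_false_inj h2⟩

theorem length_code (j n : ℕ) (y : Word) : (code j n y).length = j + n + y.length + 2 := by
  simp [code]; omega

/-- A machine that asks its oracle for `code j |x| y`, where `x` and `y` are its inputs, and
outputs the first bit of the reply. -/
abbrev lookupMachine (j : ℕ) : Machine Unit 2 where
  numWork := 0
  numStates := j + 4
  start := ⟨0, by omega⟩
  instr s h :=
    if hs : s.1 < j then .work h (fun _ => none) (some true) ⟨s.1 + 1, by omega⟩
    else if s.1 = j then .work h (fun _ => none) (some false) ⟨j + 1, by omega⟩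
    else if s.1 = j + 1 then
      match h (.inl 0) with
      | some _ => .work h (Function.update (fun _ => none) (.inl 0) (some .right)) (some true) s
      | none => .work h (fun _ => none) (some false) ⟨j + 2, by omega⟩
    else if s.1 = j + 2 then
      match h (.inl 1) with
      | some b => .work h (Function.update (fun _ => none) (.inl 1) (some .right)) (some b) s
      | none => .ask () ⟨j + 3, by omega⟩
    else
      -- The answer cell is blanked without moving the head, so the next step halts after exactly
      -- one bit.
      match h (.inr none) with
      | some b => .work (Function.update h (.inr none) none) (fun _ => none) (some b) s
      | none => .halt

namespace lookupMachine

variable {j : ℕ} {O : Unit → Word → Word}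

theorem iterate_prefix (T : TapeIx 2 0 → Turing.Tape (Option Bool)) (k : ℕ) (hk : k ≤ j) :
    ((lookupMachine j).step O)^[k] ⟨⟨0, by simp⟩, T, []⟩ =
      ⟨⟨k, by simp; omega⟩, T, List.replicate k true⟩ := by
  induction k with
  | zero => rfl
  | succ k ih =>
    rw [Function.iterate_succ_apply', ih (by omega)]
    have : k < j := hk
    simp [Machine.step, Machine.current, lookupMachine, this, List.replicate_succ']

theorem step_separator (T : TapeIx 2 0 → Turing.Tape (Option Bool)) (out : Word) :
    (lookupMachine j).step O ⟨⟨j, by simp⟩, T, out⟩ =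
      ⟨⟨j + 1, by simp⟩, T, out ++ [false]⟩ := by
  simp [Machine.step, Machine.current, lookupMachine]

theorem iterate_left (x : Word) (L : Turing.ListBlank (Option Bool))
    (T : TapeIx 2 0 → Turing.Tape (Option Bool)) (out : Word)
    (hT : T (.inl 0) = Turing.Tape.mk' L (Turing.ListBlank.mk (x.map some))) :
    ∃ T', T' (.inl 1) = T (.inl 1) ∧
      ((lookupMachine j).step O)^[x.length + 1] ⟨⟨j + 1, by simp⟩, T, out⟩ =
        ⟨⟨j + 2, by simp⟩, T', out ++ (List.replicate x.length true ++ [false])⟩ := by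
  induction x generalizing L T out with
  | nil =>
    refine ⟨T, rfl, ?_⟩
    have h := head_mk_map_nil L
    rw [← hT] at h
    simp [Machine.step, Machine.current, lookupMachine, h]
  | cons b x ih =>
    have h := head_mk_map_cons L b x
    have h' := move_right_mk_map_cons L b x
    rw [← hT] at h h'
    obtain ⟨T', hT', e⟩ := ih (L.cons (some b))
      (Function.update T (.inl 0) ((T (.inl 0)).move .right)) (out ++ [true]) (by simp [h'])
    refine ⟨T', by simpa using hT', ?_⟩
    rw [List.length_cons, Function.iterate_succ_apply]
    convert e using 1
    · congr 1
      simp only [Machine.step, Machine.current, lookupMachine, h]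
      simp
      funext k
      by_cases hk : k = .inl 0
      · subst hk; simp
      · simp [hk]
    · simp [List.replicate_succ]

theorem iterate_right (y : Word) (L : Turing.ListBlank (Option Bool))
    (T : TapeIx 2 0 → Turing.Tape (Option Bool)) (out : Word)
    (hT : T (.inl 1) = Turing.Tape.mk' L (Turing.ListBlank.mk (y.map some))) :
    ∃ T', T' (.inr none) = wordTape (O () (out ++ y)) ∧
      ((lookupMachine j).step O)^[y.length + 1] ⟨⟨j + 2, by simp⟩, T, out⟩ =
        ⟨⟨j + 3, by simp⟩, T', []⟩ := by
  induction y generalizing L T out with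
  | nil =>
    refine ⟨Function.update T (.inr none) (wordTape (O () out)), by simp, ?_⟩
    have h := head_mk_map_nil L
    rw [← hT] at h
    simp [Machine.step, Machine.current, lookupMachine, h]
  | cons b y ih =>
    have h := head_mk_map_cons L b y
    have h' := move_right_mk_map_cons L b y
    rw [← hT] at h h'
    obtain ⟨T', hT', e⟩ := ih (L.cons (some b))
      (Function.update T (.inl 1) ((T (.inl 1)).move .right)) (out ++ [b]) (by simp [h'])
    refine ⟨T', by simpa using hT', ?_⟩
    rw [List.length_cons, Function.iterate_succ_apply]
    convert e using 1
    congr 1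
    simp only [Machine.step, Machine.current, lookupMachine, h]
    simp
    funext k
    by_cases hk : k = .inl 1
    · subst hk; simp
    · simp [hk]

theorem step_answer (b : Bool) (T : TapeIx 2 0 → Turing.Tape (Option Bool))
    (hT : T (.inr none) = wordTape [b]) :
    ∃ c, (lookupMachine j).step O ⟨⟨j + 3, by simp⟩, T, []⟩ = c ∧
      (lookupMachine j).current c = .halt ∧ c.out = [b] := by
  have h : (T (.inr none)).head = some b := by
    rw [hT]; exact head_mk_map_cons _ b []
  refine ⟨_, rfl, ?_, ?_⟩ <;>
    simp [Machine.step, Machine.current, lookupMachine, h, Turing.Tape.write]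

theorem haltsWithin (x y : Word) (b : Bool) (hb : O () (code j x.length y) = [b]) :
    (lookupMachine j).HaltsWithin O ![x, y] (x.length + y.length + (j + 4)) [b] := by
  obtain ⟨T₁, hT₁, e₁⟩ := iterate_left (j := j) (O := O) x (Turing.ListBlank.mk [])
    ((lookupMachine j).init ![x, y]).tape (List.replicate j true ++ [false]) rfl
  obtain ⟨T₂, hT₂, e₂⟩ := iterate_right (j := j) (O := O) y (Turing.ListBlank.mk []) T₁
    (List.replicate j true ++ [false] ++ (List.replicate x.length true ++ [false])) hT₁
  have hcode : List.replicate j true ++ [false] ++ (List.replicate x.length true ++ [false]) ++ y =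
      code j x.length y := by simp [code]
  rw [hcode, hb] at hT₂
  obtain ⟨c, hc, hhalt, hout⟩ := step_answer (j := j) (O := O) b T₂ hT₂
  have key : (lookupMachine j).conf O ![x, y] (x.length + y.length + (j + 4)) = c := by
    have e : x.length + y.length + (j + 4) =
      1 + ((y.length + 1) + ((x.length + 1) + (1 + j))) := by omega
    rw [e, Machine.conf, Function.iterate_add_apply, Function.iterate_add_apply _ (y.length + 1),
      Function.iterate_add_apply _ (x.length + 1), Function.iterate_add_apply _ 1 j]
    have e₀ := iterate_prefix (j := j) (O := O) ((lookupMachine j).init ![x, y]).tape j le_rfl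
    change _ = _ at e₀
    rw [show (lookupMachine j).init ![x, y] = ⟨⟨0, by simp⟩,
      ((lookupMachine j).init ![x, y]).tape, []⟩ from rfl, e₀, Function.iterate_one,
      step_separator, e₁, e₂, hc]
  exact ⟨by rw [key]; exact hhalt, by rw [key]; exact hout⟩

end lookupMachine

/-- The problem of finding, on input `x`, a word `y` with `|y| ≤ |x|` and `code j |x| y ∈ A`. -/
noncomputable def lookupProblem (A : Set Word) (j : ℕ)
    (h : ∀ n, ∃ y : Word, y.length ≤ n ∧ code j n y ∈ A) : TotalSearchProblem A where
  rel x y := code j x.length y ∈ A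
  bound := Polynomial.X
  decidable := ⟨lookupMachine j, Polynomial.X + Polynomial.C (j + 4), fun x y => by
    simpa using lookupMachine.haltsWithin (O := fun _ => membership A) x y _ rfl⟩
  total x := by simpa using h x.length

/-! ### Forcing conditions and presentations -/

/-- `A` and `B` have the same words of length less than `N`. -/
def AgreeBelow (N : ℕ) (A B : Set Word) : Prop :=
  ∀ w : Word, w.length < N → (w ∈ A ↔ w ∈ B)

namespace AgreeBelow

variable {M N : ℕ} {A B C : Set Word}

theorem trans (h : AgreeBelow N A B) (h' : AgreeBelow N B C) : AgreeBelow N A C :=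
  fun w hw => (h w hw).trans (h' w hw)

theorem mono (h : AgreeBelow N A B) (hMN : M ≤ N) : AgreeBelow M A B :=
  fun w hw => h w (hw.trans_le hMN)

end AgreeBelow

theorem membership_eq_of_iff {A B : Set Word} {w : Word} (h : w ∈ A ↔ w ∈ B) :
    membership A w = membership B w := by
  simp [membership, h]

theorem AgreeBelow.haltsWithin_iff {a N T : ℕ} {A B : Set Word} (h : AgreeBelow N A B)
    (M : Machine Unit a) (x : Fin a → Word) (hT : T ≤ N) (w : Word) :
    M.HaltsWithin (fun _ => membership A) x T w ↔ M.HaltsWithin (fun _ => membership B) x T w :=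
  M.haltsWithin_congr (fun v hv _ =>
    membership_eq_of_iff (h v ((M.length_lt_of_mem_outs hv).trans_le hT))) w

/-- A forcing condition: the words of length less than `level` are decided as in `set`, and the
lookup problems with index in `committed` have to be total. -/
structure Condition where
  set : Set Word
  level : ℕ
  committed : Finset ℕ
  total : ∀ j ∈ committed, ∀ n, ∃ y : Word, y.length ≤ n ∧ code j n y ∈ set

namespace Condition

/-- `c ≤ d` means that `d` carries more information than `c`. -/
instance : Preorder Condition where
  le c d := c.level ≤ d.level ∧ c.committed ⊆ d.committed ∧ AgreeBelow c.level c.set d.set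
  le_refl c := ⟨le_rfl, subset_rfl, fun _ _ => Iff.rfl⟩
  le_trans _ _ _ h h' :=
    ⟨h.1.trans h'.1, h.2.1.trans h'.2.1, h.2.2.trans (h'.2.2.mono h.1)⟩

instance : Nonempty Condition := ⟨⟨∅, 0, ∅, by simp⟩⟩

/-- The set `A` is compatible with the decided part of `c`. -/
def Fits (c : Condition) (A : Set Word) : Prop := AgreeBelow c.level c.set A

theorem isCofinal_level (N : ℕ) : IsCofinal {c : Condition | N ≤ c.level} := fun c =>
  ⟨⟨c.set, max N c.level, c.committed, c.total⟩, le_max_left N c.level,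
    le_max_right _ _, subset_rfl, fun _ _ => Iff.rfl⟩

end Condition

/-- A machine with a time bound and a length bound for solutions, which presents a search problem
relative to any oracle. -/
structure Presentation where
  machine : Machine Unit 2
  time : Polynomial ℕ
  bound : Polynomial ℕ

namespace Presentation

instance : Countable Presentation := by
  refine Function.Injective.countable
    (f := fun e : Presentation => (e.machine, e.time, e.bound)) ?_
  rintro ⟨⟩ ⟨⟩ h
  simp_all

/-- `y` is accepted as a solution for `z`, relative to `A`. -/
def Solves (e : Presentation) (A : Set Word) (z y : Word) : Prop :=
  y.length ≤ e.bound.eval z.length ∧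
    e.machine.HaltsWithin (fun _ => membership A) ![z, y] (e.time.eval (z.length + y.length)) [true]

/-- `e` presents the search problem `S`. -/
def Presents (e : Presentation) {A : Set Word} (S : TotalSearchProblem A) : Prop :=
  ∀ z y, e.Solves A z y ↔ S.IsSolution z y

theorem exists_presents {A : Set Word} (S : TotalSearchProblem A) :
    ∃ e : Presentation, e.Presents S := by
  obtain ⟨M, p, h⟩ := S.decidable
  refine ⟨⟨M, p, S.bound⟩, fun z y => and_congr_right fun _ => ?_⟩
  constructor
  · intro hM
    have := (h z y).2.symm.trans hM.2
    simpa using this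
  · intro hr
    simpa [hr] using h z y

theorem Solves.congr {e : Presentation} {A B : Set Word} {z y : Word}
    (h : ∀ w ∈ e.machine.outs (fun _ => membership A) ![z, y] (e.time.eval (z.length + y.length)),
      w ∈ A ↔ w ∈ B) (hs : e.Solves A z y) : e.Solves B z y :=
  ⟨hs.1, (e.machine.haltsWithin_congr (fun w hw _ => membership_eq_of_iff (h w hw)) _).1 hs.2⟩

end Presentation

/-! ### Density of the requirements -/

namespace Condition

/-- `c` forces that the problem presented by `e` has an instance without solutions. -/
def Kills (c : Condition) (e : Presentation) : Prop :=
  ∃ z, ∀ A, c.Fits A → ∀ y, ¬ e.Solves A z y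

/-- The lookup problem with index `j` was committed when `e` could no longer be killed. -/
def Separates (c : Condition) (e : Presentation) (j : ℕ) : Prop :=
  j ∈ c.committed ∧ ∃ c₀ ≤ c, j ∉ c₀.committed ∧ ∀ d ≥ c₀, ¬ d.Kills e

theorem Separates.mono {c d : Condition} {e : Presentation} {j : ℕ} (h : c.Separates e j)
    (hcd : c ≤ d) : d.Separates e j := by
  obtain ⟨hj, c₀, hc₀, h⟩ := h
  exact ⟨hcd.2.1 hj, c₀, hc₀.trans hcd, h⟩

theorem isCofinal_kills_or_separates (e : Presentation) :
    IsCofinal {c : Condition | c.Kills e ∨ ∃ j, c.Separates e j} := by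
  intro c
  by_cases hk : ∃ d ≥ c, d.Kills e
  · obtain ⟨d, hd, hk⟩ := hk
    exact ⟨d, .inl hk, hd⟩
  push Not at hk
  -- Taking `j` at least the level makes every added code too long to disturb the decided part.
  obtain ⟨j, hj⟩ := Infinite.exists_notMem_finset (c.committed ∪ Finset.range c.level)
  simp only [Finset.mem_union, Finset.mem_range, not_or, not_lt] at hj
  let d : Condition :=
    { set := c.set ∪ {w | ∃ n y, w = code j n y}
      level := c.level
      committed := insert j c.committed
      total := by
        intro i hi n
        rcases Finset.mem_insert.1 hi with rfl | hi
        · exact ⟨[], by simp, .inr ⟨n, [], rfl⟩⟩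
        · obtain ⟨y, hy, h⟩ := c.total i hi n
          exact ⟨y, hy, .inl h⟩ }
  have hcd : c ≤ d := by
    refine ⟨le_rfl, Finset.subset_insert _ _, fun w hw => ⟨.inl, ?_⟩⟩
    rintro (h | ⟨n, y, rfl⟩)
    · exact h
    · rw [length_code] at hw
      omega
  exact ⟨d, .inr ⟨j, Finset.mem_insert_self _ _, c, hcd, hj.1, hk⟩, hcd⟩

/-- If no extension of `c` kills `e`, then `e` presents a total problem relative to every oracle
that meets the requirements of `c`. -/
theorem exists_solves {c : Condition} {e : Presentation} (hc : ∀ d ≥ c, ¬ d.Kills e)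
    {A : Set Word} (hA : c.Fits A)
    (htot : ∀ j ∈ c.committed, ∀ n, ∃ y : Word, y.length ≤ n ∧ code j n y ∈ A) (z : Word) :
    ∃ y, e.Solves A z y := by
  by_contra! hno
  -- Checking any admissible `y` for `z` queries only words shorter than `N`; freezing `A` up to `N`
  -- would therefore kill `e`.
  let N := e.time.eval (z.length + e.bound.eval z.length)
  refine hc ⟨A, max c.level N, c.committed, htot⟩
    ⟨le_max_left _ _, subset_rfl, hA⟩ ⟨z, fun B hB y hy => hno y ⟨hy.1, ?_⟩⟩
  exact (hB.haltsWithin_iff e.machine _ ((eval_mono e.time (by have := hy.1; omega)).trans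
    (le_max_right _ N)) _).2 hy.2

/-- `c` forces that `M`, run for time `p`, does not reduce the lookup problem with index `j` to the
problem presented by `e`. -/
def Defeats (c : Condition) (e : Presentation) (j : ℕ) (M : Machine OracleName 1)
    (p : Polynomial ℕ) : Prop :=
  ∃ (x : Word) (Z : Finset Word) (τ : Word → Word), ∀ A, c.Fits A →
    (∀ z ∈ Z, e.Solves A z (τ z)) ∧
    ∀ σ : Word → Word, (∀ z ∈ Z, σ z = τ z) → ∀ w,
      M.HaltsWithin (reductionOracles A σ) ![x] (p.eval x.length) w →
        ¬ (w.length ≤ x.length ∧ code j x.length w ∈ A)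

/-- A word of length `n` outside a given set of fewer than `2ⁿ` words. -/
theorem exists_word_notMem {n : ℕ} (s : Finset Word) (hs : s.card < 2 ^ n) :
    ∃ y : Word, y.length = n ∧ y ∉ s := by
  by_contra! h
  have : (Finset.univ.image fun v : List.Vector Bool n => v.toList) ⊆ s := by
    intro w hw
    obtain ⟨v, -, rfl⟩ := Finset.mem_image.1 hw
    exact h _ (by simp)
  have := Finset.card_le_card this
  rw [Finset.card_image_of_injective _ (fun _ _ h => List.Vector.eq _ _ h), Finset.card_univ,
    card_vector, Fintype.card_bool] at this
  omega

theorem Separates.exists_defeats {c : Condition} {e : Presentation} {j : ℕ}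
    (hc : c.Separates e j) (M : Machine OracleName 1) (p : Polynomial ℕ) :
    ∃ d ≥ c, d.Defeats e j M p := by
  obtain ⟨hj, c₀, hc₀, hj₀, hk⟩ := hc
  -- The polynomial counts the words to avoid: `q` from the reduction, `r` for verifying each of at
  -- most `q` answers, and one for the output. Since `n` is at least the level, codes for length `n`
  -- are still undecided.
  obtain ⟨n, hn, hlt⟩ := exists_polynomial_lt_two_pow
    (p + p * e.time.comp (p + e.bound.comp p) + 1) c.level
  simp only [Polynomial.eval_add, Polynomial.eval_mul, Polynomial.eval_comp,
    Polynomial.eval_one] at hlt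
  set q := p.eval n with hq
  set r := e.time.eval (q + e.bound.eval q) with hr
  -- the oracle without solutions for the instances of length `n`
  let A : Set Word := c.set \ {w | ∃ y, w = code j n y}
  have hAc : AgreeBelow c.level c.set A := fun w hw =>
    ⟨fun h => ⟨h, by rintro ⟨y, rfl⟩; rw [length_code] at hw; omega⟩, fun h => h.1⟩
  have hAne : ∀ i m, (i ≠ j ∨ m ≠ n) → ∀ y, code i m y ∈ c.set → code i m y ∈ A := by
    rintro i m him y hy
    refine ⟨hy, ?_⟩
    rintro ⟨y', h⟩
    obtain ⟨rfl, rfl, -⟩ := code_inj.1 h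
    simp at him
  -- Totality is drawn from `c₀`, not `c`: `A` breaks the promise for `j`, which `c₀` has not made.
  have hsolve : ∀ z, ∃ y, e.Solves A z y := by
    refine exists_solves hk (hc₀.2.2.trans (hAc.mono hc₀.1)) fun i hi m => ?_
    obtain ⟨y, hy, h⟩ := c.total i (hc₀.2.1 hi) m
    exact ⟨y, hy, hAne i m (.inl (by rintro rfl; exact hj₀ hi)) y h⟩
  choose τ hτ using hsolve
  let x : Word := List.replicate n true
  have hx : x.length = n := List.length_replicate
  let Z := M.outs (reductionOracles A τ) ![x] q
  let V : Word → Finset Word := fun z => e.machine.outs (fun _ => membership A) ![z, τ z]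
    (e.time.eval (z.length + (τ z).length))
  have hVr : ∀ z ∈ Z, e.time.eval (z.length + (τ z).length) ≤ r := by
    intro z hz
    have hzq : z.length ≤ q := (M.length_lt_of_mem_outs hz).le
    exact eval_mono e.time (add_le_add hzq ((hτ z).1.trans (eval_mono e.bound hzq)))
  let w₀ := (M.conf (reductionOracles A τ) ![x] q).out
  let used : Finset Word := insert (code j n w₀) (Z ∪ Z.biUnion V)
  have hcard : used.card ≤ q + q * r + 1 := by
    have h1 : Z.card ≤ q := M.card_outs_le _ _ _
    have h2 : (Z.biUnion V).card ≤ Z.card * r := Finset.card_biUnion_le_card_mul _ _ _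
      fun z hz => (e.machine.card_outs_le _ _ _).trans (hVr z hz)
    have h3 := Finset.card_insert_le (code j n w₀) (Z ∪ Z.biUnion V)
    have h4 := Finset.card_union_le Z (Z.biUnion V)
    have h5 : Z.card * r ≤ q * r := Nat.mul_le_mul_right _ h1
    change (insert (code j n w₀) (Z ∪ Z.biUnion V)).card ≤ _
    omega
  obtain ⟨y, hyn, hy⟩ : ∃ y : Word, y.length = n ∧ code j n y ∉ used := by
    obtain ⟨y, hyn, hy⟩ := exists_word_notMem (n := n)
      (used.preimage (code j n) fun _ _ _ _ h => (code_inj.1 h).2.2)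
      ((Finset.card_le_card_of_injOn (code j n) (fun y hy => Finset.mem_preimage.1 hy)
        fun _ _ _ _ h => (code_inj.1 h).2.2).trans_lt (hcard.trans_lt hlt))
    exact ⟨y, hyn, fun h => hy (Finset.mem_preimage.2 h)⟩
  let d : Condition :=
    { set := insert (code j n y) A
      -- High enough to freeze the queries of the reduction, those of the verifications, and every
      -- `code j n w` with `|w| ≤ n`.
      level := c.level + q + r + (j + n + n + 3)
      committed := c.committed
      total := by
        intro i hi m
        by_cases him : i = j ∧ m = n
        · obtain ⟨rfl, rfl⟩ := him
          exact ⟨y, hyn.le, .inl rfl⟩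
        · obtain ⟨v, hv, h⟩ := c.total i hi m
          exact ⟨v, hv, .inr (hAne i m (by tauto) v h)⟩ }
  have hfit : ∀ B, d.Fits B → ∀ w : Word, w.length < d.level → w ≠ code j n y →
      (w ∈ A ↔ w ∈ B) := by
    intro B hB w hw hne
    rw [← hB w hw]
    simp [d, hne]
  refine ⟨d, ⟨by simp only [d]; omega, subset_rfl, fun w hw => ?_⟩, x, Z, τ, fun B hB => ⟨?_, ?_⟩⟩
  · rw [hAc w hw]
    have : w ≠ code j n y := by rintro rfl; rw [length_code] at hw; omega
    simp [d, this]
  · intro z hz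
    refine (hτ z).congr fun w hw => hfit B hB w ?_ ?_
    · have h1 := e.machine.length_lt_of_mem_outs hw
      have h2 := hVr z hz
      simp only [d]
      omega
    · rintro rfl
      exact hy (by simp only [used, Finset.mem_insert, Finset.mem_union, Finset.mem_biUnion]
                   exact .inr (.inr ⟨z, hz, hw⟩))
  · intro σ hσ w hw
    rw [hx] at hw ⊢
    have hrun := M.haltsWithin_congr (O := reductionOracles A τ) (O' := reductionOracles B σ)
      (x := ![x]) (T := q) (fun v hv i => by
        cases i with
        | ambient =>
          refine membership_eq_of_iff (hfit B hB v ?_ ?_)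
          · have := M.length_lt_of_mem_outs hv
            simp only [d]
            omega
          · rintro rfl
            exact hy (by simp only [used, Finset.mem_insert, Finset.mem_union]
                         exact .inr (.inl hv))
        | solver => exact (hσ v hv).symm) w
    have hw₀ : w₀ = w := (hrun.2 hw).2
    rintro ⟨hwn, hwB⟩
    have hne : code j n w ≠ code j n y := by
      intro h
      exact hy (by rw [← h, ← hw₀]; exact Finset.mem_insert_self _ _)
    have := (hfit B hB _ (by rw [length_code]; simp only [d]; omega) hne).2 hwB
    exact this.2 ⟨w, rfl⟩

theorem isCofinal_defeats_or_not_separates (e : Presentation) (j : ℕ)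
    (M : Machine OracleName 1) (p : Polynomial ℕ) :
    IsCofinal {c : Condition | c.Defeats e j M p ∨ ∀ d ≥ c, ¬ d.Separates e j} := by
  intro c
  by_cases h : ∃ d ≥ c, d.Separates e j
  · obtain ⟨d, hd, h⟩ := h
    obtain ⟨d', hd', h'⟩ := h.exists_defeats M p
    exact ⟨d', .inl h', hd.trans hd'⟩
  · push Not at h
    exact ⟨c, .inr h, le_rfl⟩

end Condition

/-! ### The generic oracle -/

/-- The requirements that a generic oracle meets. -/
def requirement : ℕ ⊕ Presentation ⊕
    (Presentation × ℕ × Machine OracleName 1 × Polynomial ℕ) → Set Condition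
  | .inl N => {c | N ≤ c.level}
  | .inr (.inl e) => {c | c.Kills e ∨ ∃ j, c.Separates e j}
  | .inr (.inr (e, j, M, p)) => {c | c.Defeats e j M p ∨ ∀ d ≥ c, ¬ d.Separates e j}

theorem isCofinal_requirement : ∀ i, IsCofinal (requirement i)
  | .inl N => Condition.isCofinal_level N
  | .inr (.inl e) => Condition.isCofinal_kills_or_separates e
  | .inr (.inr (e, j, M, p)) => Condition.isCofinal_defeats_or_not_separates e j M p

/-- The oracle determined by an ideal of conditions. -/
def idealOracle (I : Order.Ideal Condition) : Set Word :=
  {w | ∃ c ∈ I, w.length < c.level ∧ w ∈ c.set}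

theorem fits_idealOracle {I : Order.Ideal Condition} {c : Condition} (hc : c ∈ I) :
    c.Fits (idealOracle I) := by
  refine fun w hw => ⟨fun h => ⟨c, hc, hw, h⟩, ?_⟩
  rintro ⟨d, hd, hwd, h⟩
  obtain ⟨b, -, hcb, hdb⟩ := I.directed c hc d hd
  exact (hcb.2.2 w hw).2 ((hdb.2.2 w hwd).1 h)

theorem idealOracle_total {I : Order.Ideal Condition} (hI : ∀ N, ∃ c ∈ I, N ≤ c.level)
    {c : Condition} (hc : c ∈ I) {j : ℕ} (hj : j ∈ c.committed) (n : ℕ) :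
    ∃ y : Word, y.length ≤ n ∧ code j n y ∈ idealOracle I := by
  -- A code with `|y| ≤ n` has length at most `j + n + n + 2`, so the witness is already decided.
  obtain ⟨d, hd, hN⟩ := hI (j + n + n + 3)
  obtain ⟨b, hb, hcb, hdb⟩ := I.directed c hc d hd
  obtain ⟨y, hy, h⟩ := b.total j (hcb.2.1 hj) n
  refine ⟨y, hy, b, hb, ?_, h⟩
  have := hdb.1
  rw [length_code]
  omega

theorem not_isComplete_idealOracle {I : Order.Ideal Condition}
    (hI : ∀ i, ∃ c ∈ I, c ∈ requirement i) (S : TotalSearchProblem (idealOracle I)) :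
    ¬ IsComplete S := by
  intro hS
  obtain ⟨e, he⟩ := Presentation.exists_presents S
  obtain ⟨c, hc, hce⟩ := hI (.inr (.inl e))
  rcases hce with ⟨z, hz⟩ | ⟨j, hcj⟩
  · obtain ⟨y, hy⟩ := S.total z
    exact hz _ (fits_idealOracle hc) y ((he z y).2 hy)
  obtain ⟨M, p, hM⟩ := hS (lookupProblem (idealOracle I) j
    (idealOracle_total (fun N => hI (.inl N)) hc hcj.1))
  obtain ⟨d, hd, hdM⟩ := hI (.inr (.inr (e, j, M, p)))
  rcases hdM with ⟨x, Z, τ, h⟩ | hdM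
  · obtain ⟨hZ, hfail⟩ := h _ (fits_idealOracle hd)
    choose s hs using S.total
    classical
    -- Splicing `τ` into a true solver is legitimate because `τ` solves `e` on `Z` relative to the
    -- generic oracle.
    let σ : Word → Word := fun z => if z ∈ Z then τ z else s z
    have hσ : ∀ z, S.IsSolution z (σ z) := by
      intro z
      by_cases hz : z ∈ Z
      · simpa [σ, hz] using (he z _).1 (hZ z hz)
      · rw [show σ z = s z from if_neg hz]
        exact hs z
    obtain ⟨⟨w, hw, hsol⟩, -⟩ := hM σ hσ x
    refine hfail σ (fun z hz => by simp [σ, hz]) w hw ?_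
    simpa [TotalSearchProblem.IsSolution, lookupProblem] using hsol
  -- Separation persists to a common extension of `c` and `d`, which `d` rules out.
  · obtain ⟨b, -, hcb, hdb⟩ := I.directed c hc d hd
    exact hdM b hdb (hcj.mono hcb)

end OracleSearch

theorem mainTheorem4 :
    ∃ A : Set OracleSearch.Word,
      ¬ ∃ S : OracleSearch.TotalSearchProblem A, OracleSearch.IsComplete S := by
  obtain ⟨I, hI⟩ := OracleSearch.exists_generic_ideal OracleSearch.requirement
    OracleSearch.isCofinal_requirement
  exact ⟨OracleSearch.idealOracle I, fun ⟨S, hS⟩ =>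
    OracleSearch.not_isComplete_idealOracle hI S hS⟩
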